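/- Let $N\ge 0$ and $d\ge 0$ be integers, let $c\in\{0,N\}$, and let $[x_k]=(x_0,\dots,x_N)$ be a sequence of $\mathbb{R}^d$-valued random vectors on a probability space. A random vector is called ZMNG if it is Gaussian with zero mean and nonsingular covariance matrix, and a finite sequence of random vectors is called ZMNG if the vector obtained by stacking all its terms is ZMNG. A sequence is Markov if, for every time $j$, the terms before $j$ and the terms after $j$ are conditionally independent given the term at time $j$. The sequence $[x_k]$ is $CM_c$ if, conditioned on $x_c$, it is Markov over the remaining times, i.e. for every $j\in[0,N]\setminus\{c\}$ the families $\{x_i : i<j,\ i\ne c\}$ and $\{x_i : i>j,\ i\neq c\}$ are conditionally independent given $(x_j,x_c)$. Suppose that $[x_k]$ is ZMNG. Then $[x_k]$ is $CM_c$ if and only if there exist a sequence $(y_k)_{k\in[0,N]\setminus\{c\}}$ of $\mathbb{R}^d$-valued random vectors on the same probability space and real $d\times d$ matrices $\Gamma_k$, $k\in[0,N]\setminus\{c\}$, such that $$x_k = y_k+\Gamma_k x_c,\qquad k\in[0,N]\setminus\{c\},$$ where $(y_k)_{k\ne c}$ is a ZMNG Markov sequence and $x_c$ is a ZMNG vector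 uncorrelated with $(y_k)_{k\neq c}$ (i.e. $\operatorname{Cov}(y_k,x_c)=0$ for all $k\ne c$). -/

import Mathlib

open MeasureTheory ProbabilityTheory

/-- The covariance matrix of a real random vector `v` with coordinates indexed by `κ`. -/
noncomputable def covMatrix {Ω κ : Type*} [MeasurableSpace Ω] (P : Measure Ω)
    (v : Ω → κ → ℝ) : Matrix κ κ ℝ :=
  Matrix.of fun i j => cov[fun ω => v ω i, fun ω => v ω j; P]

/-- `v` is a zero-mean nonsingular Gaussian (ZMNG) random vector: its law is Gaussian, its mean
is zero, and its covariance matrix is nonsingular. -/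
structure IsZMNG {Ω κ : Type*} [MeasurableSpace Ω] [Fintype κ] [DecidableEq κ] (P : Measure Ω)
    (v : Ω → κ → ℝ) : Prop where
  measurable : Measurable v
  gaussian : HasGaussianLaw v P
  zero_mean : ∀ i, ∫ ω, v ω i ∂P = 0
  nonsingular : (covMatrix P v).det ≠ 0

/-- The stacked vector of all the coordinates of a sequence of `d`-dimensional random vectors.
The sequence is called ZMNG when this vector is, so Gaussianity and nonsingularity are those of
the joint law of the whole sequence. -/
def stack {Ω ι : Type*} {d : ℕ} (x : ι → Ω → Fin d → ℝ) : Ω → ι × Fin d → ℝ :=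
  fun ω p => x p.1 ω p.2

/-- Two random vectors are uncorrelated: their cross-covariance matrix vanishes. -/
def Uncorrelated {Ω κ κ' : Type*} [MeasurableSpace Ω] (P : Measure Ω)
    (u : Ω → κ → ℝ) (v : Ω → κ' → ℝ) : Prop :=
  ∀ i j, cov[fun ω => u ω i, fun ω => v ω j; P] = 0

/-- The sigma-algebra generated by the random vectors `x k`, `k ∈ S`. -/
abbrev sigmaOf {Ω ι E : Type*} [MeasurableSpace E] (x : ι → Ω → E) (S : Set ι) :
    MeasurableSpace Ω :=
  ⨆ k ∈ S, MeasurableSpace.comap (x k) inferInstance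

/-- Conditioned on the sigma-algebra `m`, the sequence `x` is Markov: for every time `j`, the past
(the states before `j`) and the future (the states after `j`) are conditionally independent
given `m` and the state `x j`. -/
def IsMarkovGiven {Ω ι E : Type*} [MeasurableSpace Ω] [MeasurableSpace E] [LinearOrder ι]
    (P : Measure Ω) (m : MeasurableSpace Ω) (x : ι → Ω → E) : Prop :=
  ∀ j : ι, ∀ A B : Set Ω,
    MeasurableSet[sigmaOf x (Set.Iio j)] A → MeasurableSet[sigmaOf x (Set.Ioi j)] B →
      P⟦A ∩ B | m ⊔ sigmaOf x {j}⟧ =ᵐ[P]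
        P⟦A | m ⊔ sigmaOf x {j}⟧ * P⟦B | m ⊔ sigmaOf x {j}⟧

/-- `x` is a Markov sequence. -/
def IsMarkovSeq {Ω ι E : Type*} [MeasurableSpace Ω] [MeasurableSpace E] [LinearOrder ι]
    (P : Measure Ω) (x : ι → Ω → E) : Prop :=
  IsMarkovGiven P ⊥ x

/-- The sequence `x` with the state at time `c` removed. -/
def dropAt {Ω ι E : Type*} (x : ι → Ω → E) (c : ι) : {k : ι // k ≠ c} → Ω → E :=
  fun k => x k

/-- `x` is conditionally Markov `CM_c`: conditioned on the state `x c`, it is Markov over the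
remaining times. (Used for `c` the first or the last time of the index interval.) -/
def IsCM {Ω ι E : Type*} [MeasurableSpace Ω] [MeasurableSpace E] [LinearOrder ι]
    (P : Measure Ω) (c : ι) (x : ι → Ω → E) : Prop :=
  IsMarkovGiven P (sigmaOf x {c}) (dropAt x c)

/-! Regress each `x k` on `x c`: the matrix `Γ k` = Cov(x_k, x_c) Cov(x_c)⁻¹ makes the residual `y
k` uncorrelated with `x c`. All these vectors are linear images of one Gaussian vector, so `y` is
even independent of `x c`. Given `x c`, knowing `x k` and knowing `y k` are the same, and
conditional independence survives adjoining the conditioning sigma-algebra to both sides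
(`condExp_indicator_inter_sup`). Hence `CM_c` for `x` says that `y` is Markov given `x c`, and
independence removes that conditioning (`condExp_sup_eq_of_indep`). The equivalence holds for every
such decomposition (`isCM_iff_isMarkovSeq`), so it serves both directions. -/

/-! ### Conditional expectation and conditional independence of sigma-algebras. -/

section CondExp

variable {Ω : Type*}

/-- The intersections of a set of `m₁` with a set of `m₂` generate `m₁ ⊔ m₂`. -/
lemma generateFrom_inter_eq_sup (m₁ m₂ : MeasurableSpace Ω) :
    m₁ ⊔ m₂ = MeasurableSpace.generateFrom
      {s | ∃ a b, MeasurableSet[m₁] a ∧ MeasurableSet[m₂] b ∧ s = a ∩ b} := by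
  apply le_antisymm
  · refine sup_le (fun s hs ↦ ?_) (fun s hs ↦ ?_)
    · exact MeasurableSpace.measurableSet_generateFrom
        ⟨s, Set.univ, hs, @MeasurableSet.univ _ m₂, by simp⟩
    · exact MeasurableSpace.measurableSet_generateFrom
        ⟨Set.univ, s, @MeasurableSet.univ _ m₁, hs, by simp⟩
  · refine MeasurableSpace.generateFrom_le ?_
    rintro _ ⟨a, b, ha, hb, rfl⟩
    exact @MeasurableSet.inter _ (m₁ ⊔ m₂) _ _ ((le_sup_left : m₁ ≤ m₁ ⊔ m₂) _ ha)
      ((le_sup_right : m₂ ≤ m₁ ⊔ m₂) _ hb)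

lemma isPiSystem_inter_measurableSet (m₁ m₂ : MeasurableSpace Ω) :
    IsPiSystem {s | ∃ a b, MeasurableSet[m₁] a ∧ MeasurableSet[m₂] b ∧ s = a ∩ b} := by
  rintro _ ⟨a, b, ha, hb, rfl⟩ _ ⟨a', b', ha', hb', rfl⟩ -
  exact ⟨a ∩ a', b ∩ b', @MeasurableSet.inter _ m₁ _ _ ha ha', @MeasurableSet.inter _ m₂ _ _ hb hb',
    Set.inter_inter_inter_comm a b a' b'⟩

lemma indicator_one_mul_eq (A : Set Ω) (g : Ω → ℝ) :
    A.indicator (fun _ ↦ (1 : ℝ)) * g = A.indicator g := by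
  ext ω
  by_cases h : ω ∈ A <;> simp [h]

variable {m₁ m₂ G F M H : MeasurableSpace Ω} [m₀ : MeasurableSpace Ω] {P : Measure Ω}
  [IsProbabilityMeasure P]

/-- To identify a conditional expectation given `m₁ ⊔ m₂` it suffices to integrate over
intersections of a set of `m₁` and a set of `m₂`. -/
lemma ae_eq_condExp_sup (h₁ : m₁ ≤ m₀) (h₂ : m₂ ≤ m₀) {f g : Ω → ℝ}
    (hf : Integrable f P) (hg : Integrable g P) (hgm : AEStronglyMeasurable[m₁ ⊔ m₂] g P)
    (h : ∀ a b, MeasurableSet[m₁] a → MeasurableSet[m₂] b →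
      ∫ ω in a ∩ b, g ω ∂P = ∫ ω in a ∩ b, f ω ∂P) :
    g =ᵐ[P] P[f | m₁ ⊔ m₂] := by
  have hle : m₁ ⊔ m₂ ≤ m₀ := sup_le h₁ h₂
  refine ae_eq_condExp_of_forall_setIntegral_eq hle hf (fun s _ _ ↦ hg.integrableOn)
    (fun s hs _ ↦ ?_) hgm
  -- Equality of the total integrals is what closes the complement case.
  have huniv : ∫ ω, g ω ∂P = ∫ ω, f ω ∂P := by
    simpa using h Set.univ Set.univ (@MeasurableSet.univ _ m₁) (@MeasurableSet.univ _ m₂)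
  induction s, hs using MeasurableSpace.induction_on_inter (generateFrom_inter_eq_sup m₁ m₂)
    (isPiSystem_inter_measurableSet m₁ m₂) with
  | empty => simp
  | basic s hs =>
    obtain ⟨a, b, ha, hb, rfl⟩ := hs
    exact h a b ha hb
  | compl s hs ih =>
    have hg' := integral_add_compl (hle _ hs) hg
    have hf' := integral_add_compl (hle _ hs) hf
    have := ih (measure_lt_top P s)
    linarith
  | iUnion s hd hs ih =>
    rw [integral_iUnion (fun i ↦ hle _ (hs i)) hd hg.integrableOn,
      integral_iUnion (fun i ↦ hle _ (hs i)) hd hf.integrableOn]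
    exact tsum_congr fun i ↦ ih i (measure_lt_top P _)

/-- Conditioning in addition on an independent sigma-algebra changes nothing. -/
lemma condExp_sup_eq_of_indep (hG : G ≤ m₀) (hM : M ≤ m₀) (hF : F ≤ M)
    (hind : Indep M G P) {f : Ω → ℝ} (hfm : StronglyMeasurable[M] f) (hf : Integrable f P) :
    P[f | G ⊔ F] =ᵐ[P] P[f | F] := by
  have hF₀ : F ≤ m₀ := hF.trans hM
  -- Integrals over `a` factor by independence; this is applied to both `f` and `P[f | F]`, cut off
  -- to `b`.
  have key : ∀ u : Ω → ℝ, StronglyMeasurable[M] u → Integrable u P → ∀ a, MeasurableSet[G] a →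
      ∫ ω in a, u ω ∂P = P.real a * ∫ ω, u ω ∂P := by
    intro u hum hu a ha
    rw [← setIntegral_condExp hG hu ha,
      setIntegral_congr_ae (g := fun _ ↦ ∫ ω, u ω ∂P) (hG _ ha)
        ((condExp_indep_eq hM hG hum hind).mono fun ω h _ ↦ h)]
    simp
  have hgm : StronglyMeasurable[F] (P[f | F]) := stronglyMeasurable_condExp
  have hgm' : StronglyMeasurable[G ⊔ F] (P[f | F]) := hgm.mono le_sup_right
  refine (ae_eq_condExp_sup hG hF₀ hf integrable_condExp
    hgm'.aestronglyMeasurable fun a b ha hb ↦ ?_).symm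
  rw [← setIntegral_indicator (hF₀ _ hb), ← setIntegral_indicator (hF₀ _ hb),
    key _ ((hgm.mono hF).indicator (hF _ hb)) (integrable_condExp.indicator (hF₀ _ hb)) a ha,
    key _ (hfm.indicator (hF _ hb)) (hf.indicator (hF₀ _ hb)) a ha,
    integral_indicator (hF₀ _ hb), integral_indicator (hF₀ _ hb), setIntegral_condExp hF₀ hf hb]

lemma integrable_indicator_one {A : Set Ω} (hA : MeasurableSet A) :
    Integrable (A.indicator fun _ ↦ (1 : ℝ)) P :=
  (integrable_const 1).indicator hA

/-- Tower property through `m₁ ⊔ H`: `A` pulls out of the inner expectation, and P(B | H) out of the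
outer one. -/
lemma condExp_indicator_inter_of_condExp_sup_eq (h₁ : m₁ ≤ m₀)
    (hH : H ≤ m₀) {A B : Set Ω} (hA : MeasurableSet[m₁ ⊔ H] A) (hB : MeasurableSet B)
    (h : P⟦B | m₁ ⊔ H⟧ =ᵐ[P] P⟦B | H⟧) :
    P⟦A ∩ B | H⟧ =ᵐ[P] P⟦A | H⟧ * P⟦B | H⟧ := by
  have hA₀ : MeasurableSet A := sup_le h₁ hH _ hA
  have e : (A ∩ B).indicator (fun _ ↦ (1 : ℝ)) = A.indicator (B.indicator fun _ ↦ 1) := by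
    rw [Set.indicator_indicator]
  calc P⟦A ∩ B | H⟧ =ᵐ[P] P[P⟦A ∩ B | m₁ ⊔ H⟧ | H] :=
        (condExp_condExp_of_le le_sup_right (sup_le h₁ hH)).symm
    _ =ᵐ[P] P[A.indicator (fun _ ↦ (1 : ℝ)) * P⟦B | H⟧ | H] := by
        apply condExp_congr_ae
        rw [e, indicator_one_mul_eq]
        refine (condExp_indicator (integrable_indicator_one hB) hA).trans ?_
        filter_upwards [h] with ω hω
        simp only [Set.indicator]
        split_ifs <;> simp [hω]
    _ =ᵐ[P] P⟦A | H⟧ * P⟦B | H⟧ := by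
        refine condExp_mul_of_stronglyMeasurable_right stronglyMeasurable_condExp ?_
          (integrable_indicator_one hA₀)
        rw [indicator_one_mul_eq]
        exact integrable_condExp.indicator hA₀

/-- Converse of the previous lemma for events of `m₁`. On `a ∩ b` with `b` in `H`, condition on `H`:
the hypothesis identifies E[1_a P(B | H) | H] with P(a ∩ B | H). -/
lemma condExp_sup_eq_of_condExp_indicator_inter (h₁ : m₁ ≤ m₀)
    (hH : H ≤ m₀) {B : Set Ω} (hB : MeasurableSet B)
    (h : ∀ A, MeasurableSet[m₁] A → P⟦A ∩ B | H⟧ =ᵐ[P] P⟦A | H⟧ * P⟦B | H⟧) :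
    P⟦B | m₁ ⊔ H⟧ =ᵐ[P] P⟦B | H⟧ := by
  have hgm : StronglyMeasurable[H] (P⟦B | H⟧) := stronglyMeasurable_condExp
  have hgm' : StronglyMeasurable[m₁ ⊔ H] (P⟦B | H⟧) := hgm.mono le_sup_right
  refine (ae_eq_condExp_sup h₁ hH (integrable_indicator_one hB) integrable_condExp
    hgm'.aestronglyMeasurable fun a b ha hb ↦ ?_).symm
  have ha₀ := h₁ _ ha
  have hi : Integrable (a.indicator (fun _ ↦ (1 : ℝ)) * P⟦B | H⟧) P := by
    rw [indicator_one_mul_eq]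
    exact integrable_condExp.indicator ha₀
  have e : P[a.indicator (fun _ ↦ (1 : ℝ)) * P⟦B | H⟧ | H] =ᵐ[P] P⟦a ∩ B | H⟧ :=
    (condExp_mul_of_stronglyMeasurable_right hgm hi (integrable_indicator_one ha₀)).trans
      (h a ha).symm
  rw [Set.inter_comm, ← setIntegral_indicator ha₀, ← setIntegral_indicator ha₀,
    Set.indicator_indicator, ← setIntegral_condExp hH
      (integrable_indicator_one (ha₀.inter hB)) hb,
    ← setIntegral_congr_ae (hH _ hb) (e.mono fun ω h _ ↦ h), setIntegral_condExp hH hi hb,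
    indicator_one_mul_eq]

/-- Conditional independence given `H` is not affected by enlarging both sigma-algebras by `H`. -/
lemma condExp_indicator_inter_sup (h₁ : m₁ ≤ m₀) (h₂ : m₂ ≤ m₀)
    (hH : H ≤ m₀)
    (h : ∀ A B, MeasurableSet[m₁] A → MeasurableSet[m₂] B →
      P⟦A ∩ B | H⟧ =ᵐ[P] P⟦A | H⟧ * P⟦B | H⟧) {A B : Set Ω}
    (hA : MeasurableSet[m₁ ⊔ H] A) (hB : MeasurableSet[m₂ ⊔ H] B) :
    P⟦A ∩ B | H⟧ =ᵐ[P] P⟦A | H⟧ * P⟦B | H⟧ := by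
  have hA₀ : MeasurableSet A := sup_le h₁ hH _ hA
  -- One side is enlarged at a time; the symmetric argument then enlarges the other.
  have half : ∀ B', MeasurableSet[m₂] B' → P⟦B' ∩ A | H⟧ =ᵐ[P] P⟦B' | H⟧ * P⟦A | H⟧ := by
    intro B' hB'
    rw [Set.inter_comm, mul_comm]
    exact condExp_indicator_inter_of_condExp_sup_eq h₁ hH hA (h₂ _ hB')
      (condExp_sup_eq_of_condExp_indicator_inter h₁ hH (h₂ _ hB') fun A' hA' ↦ h A' B' hA' hB')
  rw [Set.inter_comm, mul_comm]
  exact condExp_indicator_inter_of_condExp_sup_eq h₂ hH hB hA₀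
    (condExp_sup_eq_of_condExp_indicator_inter h₂ hH hA₀ half)

end CondExp

/-! ### Covariance matrices and linear images. -/

section LinearImage

variable {Ω κ κ' : Type*} [MeasurableSpace Ω] [Fintype κ] {P : Measure Ω}
  {v : Ω → κ → ℝ}

lemma IsZMNG.memLp [DecidableEq κ] (hv : IsZMNG P v) (i : κ) : MemLp (fun ω ↦ v ω i) 2 P :=
  (hv.gaussian.eval i).memLp_two

variable [IsProbabilityMeasure P]

lemma covMatrix_mulVec (hv : ∀ i, MemLp (fun ω ↦ v ω i) 2 P) (T : Matrix κ' κ ℝ) :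
    covMatrix P (fun ω ↦ T.mulVec (v ω)) = T * covMatrix P v * T.transpose := by
  ext i j
  simp only [covMatrix, Matrix.of_apply, Matrix.mulVec, dotProduct]
  rw [covariance_fun_sum_fun_sum (fun k ↦ (hv k).const_mul _) (fun k ↦ (hv k).const_mul _),
    Finset.sum_comm]
  simp only [covariance_const_mul_left, covariance_const_mul_right, Matrix.mul_apply,
    Matrix.of_apply, Matrix.transpose_apply, Finset.sum_mul]
  exact Finset.sum_congr rfl fun _ _ ↦ Finset.sum_congr rfl fun _ _ ↦ by ring

lemma posSemidef_covMatrix (hv : ∀ i, MemLp (fun ω ↦ v ω i) 2 P) : (covMatrix P v).PosSemidef := by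
  refine Matrix.PosSemidef.of_dotProduct_mulVec_nonneg ?_ fun a ↦ ?_
  · ext i j
    simpa [covMatrix] using covariance_comm _ _
  -- The quadratic form at `a` is the variance of `a ⬝ v`, read off as a 1×1 covariance matrix.
  · have h := congrFun₂ (covMatrix_mulVec hv (Matrix.of fun (_ : Unit) k ↦ a k)) () ()
    have h' : 0 ≤ covMatrix P
        (fun ω ↦ (Matrix.of fun (_ : Unit) k ↦ a k).mulVec (v ω)) () () := by
      simp only [covMatrix, Matrix.of_apply, covariance]
      exact integral_nonneg fun ω ↦ mul_self_nonneg _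
    rw [h] at h'
    refine h'.trans_eq ?_
    simp only [Matrix.mul_apply, dotProduct, Matrix.mulVec, Matrix.transpose_apply,
      Matrix.of_apply, Finset.sum_mul, Finset.mul_sum, star_trivial]
    rw [Finset.sum_comm]
    exact Finset.sum_congr rfl fun _ _ ↦ Finset.sum_congr rfl fun _ _ ↦ by ring

variable [DecidableEq κ]

lemma IsZMNG.posDef (hv : IsZMNG P v) : (covMatrix P v).PosDef :=
  (posSemidef_covMatrix hv.memLp).posDef_iff_det_ne_zero.2 hv.nonsingular

/-- The image of a ZMNG vector under a surjective linear map is ZMNG. -/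
lemma IsZMNG.map_surjective [Fintype κ'] [DecidableEq κ'] (hv : IsZMNG P v) (L : (κ → ℝ) →ₗ[ℝ] (κ' → ℝ))
    (hL : Function.Surjective L) : IsZMNG P (fun ω ↦ L (v ω)) := by
  have hg : HasGaussianLaw (fun ω ↦ L (v ω)) P :=
    hv.gaussian.map_fun (LinearMap.toContinuousLinearMap L)
  set T := LinearMap.toMatrix' L
  have hT : ∀ u, L u = T.mulVec u := fun u ↦ (LinearMap.toMatrix'_mulVec L u).symm
  refine ⟨(LinearMap.continuous_of_finiteDimensional L).measurable.comp hv.measurable, hg,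
    fun i ↦ ?_, ?_⟩
  · simp only [hT, Matrix.mulVec, dotProduct]
    rw [integral_finsetSum _ fun j _ ↦ ((hv.memLp j).integrable (by norm_num)).const_mul _]
    simp [integral_const_mul, hv.zero_mean]
  · simp only [hT]
    rw [covMatrix_mulVec hv.memLp]
    obtain ⟨B, hB⟩ := Matrix.mulVec_surjective_iff_exists_right_inverse.1
      (show Function.Surjective T.mulVec from fun z ↦ by simpa only [hT] using hL z)
    -- Surjectivity of `T` is injectivity of its transpose, which keeps `T Σ Tᵀ` positive definite.
    have hinj : Function.Injective T.vecMul := by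
      intro a b hab
      have := congrArg (fun u ↦ Matrix.vecMul u B) hab
      simpa [Matrix.vecMul_vecMul, hB] using this
    have := hv.posDef.mul_mul_conjTranspose_same (B := T) hinj
    rw [Matrix.conjTranspose_eq_transpose_of_trivial] at this
    exact this.det_pos.ne'

end LinearImage

/-! ### Transfer of the Markov property. -/

section Markov

variable {Ω ι E : Type*} [MeasurableSpace E]

lemma sigmaOf_mono (x : ι → Ω → E) {S T : Set ι} (h : S ⊆ T) : sigmaOf x S ≤ sigmaOf x T :=
  biSup_mono h

lemma comap_le_sigmaOf (x : ι → Ω → E) {S : Set ι} {k : ι} (h : k ∈ S) :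
    MeasurableSpace.comap (x k) inferInstance ≤ sigmaOf x S :=
  le_iSup₂_of_le k h le_rfl

lemma sigmaOf_singleton (x : ι → Ω → E) (k : ι) :
    sigmaOf x {k} = MeasurableSpace.comap (x k) inferInstance := by
  simp [sigmaOf]

variable {G : MeasurableSpace Ω} [m₀ : MeasurableSpace Ω]

lemma sigmaOf_le {x : ι → Ω → E} (hx : ∀ k, Measurable (x k)) (S : Set ι) : sigmaOf x S ≤ m₀ :=
  iSup₂_le fun k _ ↦ (hx k).comap_le

/-- If `z` and `y` generate the same sigma-algebras up to a sigma-algebra `G` that is independent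
of `y`, then `z` is Markov given `G` if and only if `y` is Markov. -/
lemma isMarkovGiven_iff_isMarkovSeq [LinearOrder ι] {P : Measure Ω} [IsProbabilityMeasure P]
    (hG : G ≤ m₀) {y z : ι → Ω → E} (hy : ∀ k, Measurable (y k))
    (hz : ∀ k, Measurable (z k)) (hyz : ∀ S, sigmaOf z S ⊔ G = sigmaOf y S ⊔ G)
    (hind : Indep (sigmaOf y Set.univ) G P) :
    IsMarkovGiven P G z ↔ IsMarkovSeq P y := by
  have hM : sigmaOf y Set.univ ≤ m₀ := sigmaOf_le hy _
  have hle : ∀ S, sigmaOf y S ≤ sigmaOf y Set.univ := fun S ↦ sigmaOf_mono y (Set.subset_univ S)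
  have hH : ∀ j, G ⊔ sigmaOf z {j} = G ⊔ sigmaOf y {j} := fun j ↦ by
    rw [sup_comm, hyz, sup_comm]
  have hHle : ∀ j, G ⊔ sigmaOf y {j} ≤ m₀ := fun j ↦ sup_le hG (sigmaOf_le hy _)
  have hcond : ∀ (j : ι) (A : Set Ω), MeasurableSet[sigmaOf y Set.univ] A →
      P⟦A | G ⊔ sigmaOf y {j}⟧ =ᵐ[P] P⟦A | sigmaOf y {j}⟧ := fun j A hA ↦
    condExp_sup_eq_of_indep hG hM (hle {j}) hind (stronglyMeasurable_const.indicator hA)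
      (integrable_indicator_one (hM _ hA))
  have hyz' : ∀ (S : Set ι) (j : ι),
      sigmaOf y S ≤ sigmaOf z S ⊔ (G ⊔ sigmaOf y {j}) := fun S j ↦ by
    rw [← sup_assoc, hyz, sup_assoc]
    exact le_sup_left
  have hzy' : ∀ (S : Set ι) (j : ι),
      sigmaOf z S ≤ sigmaOf y S ⊔ (G ⊔ sigmaOf y {j}) := fun S j ↦ by
    rw [← sup_assoc, ← hyz, sup_assoc]
    exact le_sup_left
  constructor
  · intro h j A B hA hB
    have hA' := hle _ _ hA
    have hB' := hle _ _ hB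
    rw [bot_sup_eq]
    have key := condExp_indicator_inter_sup (P := P) (sigmaOf_le hz (Set.Iio j))
      (sigmaOf_le hz (Set.Ioi j)) (hHle j) (fun A B hA hB ↦ by simpa only [hH] using h j A B hA hB)
      (hyz' _ j _ hA) (hyz' _ j _ hB)
    exact (hcond j _ (hA'.inter hB')).symm.trans (key.trans ((hcond j _ hA').mul (hcond j _ hB')))
  · intro h j A B hA hB
    rw [hH]
    refine condExp_indicator_inter_sup (P := P) (sigmaOf_le hy (Set.Iio j))
      (sigmaOf_le hy (Set.Ioi j)) (hHle j) (fun A B hA hB ↦ ?_) (hzy' _ j _ hA) (hzy' _ j _ hB)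
    have hA' := hle _ _ hA
    have hB' := hle _ _ hB
    have key := h j A B hA hB
    rw [bot_sup_eq] at key
    exact (hcond j _ (hA'.inter hB')).trans
      (key.trans ((hcond j _ hA').mul (hcond j _ hB')).symm)

end Markov

/-! ### Residuals of the regression on `x c`. -/

section Residual

variable {Ω ι : Type*} {d : ℕ} {c : ι}

/-- The state at time `c`. -/
def stateAt (d : ℕ) (c : ι) : (ι × Fin d → ℝ) →ₗ[ℝ] (Fin d → ℝ) where
  toFun u i := u (c, i)
  map_add' _ _ := rfl
  map_smul' _ _ := rfl

/-- Removing the contribution `Γ k *ᵥ u c` of the state at time `c` from the other states. -/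
def residualMap (Γ : {k : ι // k ≠ c} → Matrix (Fin d) (Fin d) ℝ) :
    (ι × Fin d → ℝ) →ₗ[ℝ] ({k : ι // k ≠ c} × Fin d → ℝ) :=
  LinearMap.pi fun p ↦ LinearMap.proj (p.1.1, p.2) -
    LinearMap.proj p.2 ∘ₗ (Γ p.1).mulVecLin ∘ₗ stateAt d c

lemma residualMap_apply (Γ : {k : ι // k ≠ c} → Matrix (Fin d) (Fin d) ℝ) (u : ι × Fin d → ℝ)
    (p : {k : ι // k ≠ c} × Fin d) :
    residualMap Γ u p = u (p.1, p.2) - (Γ p.1).mulVec (fun i ↦ u (c, i)) p.2 :=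
  rfl

lemma stateAt_surjective (c : ι) : Function.Surjective (stateAt d c) :=
  fun z ↦ ⟨fun p ↦ z p.2, rfl⟩

lemma residualMap_surjective [DecidableEq ι] (Γ : {k : ι // k ≠ c} → Matrix (Fin d) (Fin d) ℝ) :
    Function.Surjective (residualMap Γ) := by
  intro z
  -- With the state at `c` set to zero, the correction term vanishes.
  refine ⟨fun p ↦ if h : p.1 = c then 0 else z (⟨p.1, h⟩, p.2), ?_⟩
  ext ⟨⟨k, hk⟩, i⟩
  simp [residualMap_apply, hk, Matrix.mulVec, dotProduct]

/-- `x k` and `y k` differ by a measurable function of `x c`. -/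
lemma sigmaOf_dropAt_sup {x : ι → Ω → Fin d → ℝ} {y : {k : ι // k ≠ c} → Ω → Fin d → ℝ}
    {Γ : {k : ι // k ≠ c} → Matrix (Fin d) (Fin d) ℝ}
    (h : ∀ k : {k : ι // k ≠ c}, ∀ ω, x k ω = y k ω + (Γ k).mulVec (x c ω))
    (S : Set {k : ι // k ≠ c}) :
    sigmaOf (dropAt x c) S ⊔ sigmaOf x {c} = sigmaOf y S ⊔ sigmaOf x {c} := by
  have hΓ : ∀ (m : MeasurableSpace Ω) k, sigmaOf x {c} ≤ m →
      Measurable[m] fun ω ↦ (Γ k).mulVec (x c ω) := by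
    intro m k hm
    rw [sigmaOf_singleton] at hm
    exact (Matrix.mulVecLin (Γ k)).continuous_of_finiteDimensional.measurable.comp
      (measurable_iff_comap_le.2 hm)
  apply le_antisymm
  · refine sup_le (iSup₂_le fun k hk ↦ ?_) le_sup_right
    rw [← measurable_iff_comap_le]
    have : dropAt x c k = fun ω ↦ y k ω + (Γ k).mulVec (x c ω) := funext (h k)
    rw [this]
    exact (measurable_iff_comap_le.2 ((comap_le_sigmaOf y hk).trans le_sup_left)).add
      (hΓ _ k le_sup_right)
  · refine sup_le (iSup₂_le fun k hk ↦ ?_) le_sup_right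
    rw [← measurable_iff_comap_le]
    have : y k = fun ω ↦ dropAt x c k ω - (Γ k).mulVec (x c ω) := by
      ext1 ω
      simp [dropAt, h k ω]
    rw [this]
    exact (measurable_iff_comap_le.2 ((comap_le_sigmaOf (dropAt x c) hk).trans le_sup_left)).sub
      (hΓ _ k le_sup_right)

variable [MeasurableSpace Ω] {P : Measure Ω} [IsProbabilityMeasure P]

lemma isCM_iff_isMarkovSeq [LinearOrder ι] [Fintype ι] {x : ι → Ω → Fin d → ℝ}
    {y : {k : ι // k ≠ c} → Ω → Fin d → ℝ} {Γ : {k : ι // k ≠ c} → Matrix (Fin d) (Fin d) ℝ}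
    (hx : IsZMNG P (stack x)) (hunc : Uncorrelated P (stack y) (x c))
    (h : ∀ k : {k : ι // k ≠ c}, ∀ ω, x k ω = y k ω + (Γ k).mulVec (x c ω)) :
    IsCM P c x ↔ IsMarkovSeq P y := by
  have hxm : ∀ k, Measurable (x k) := fun k ↦ measurable_pi_lambda _ fun i ↦
    (measurable_pi_apply (k, i)).comp hx.measurable
  have hstack : stack y = fun ω ↦ residualMap Γ (stack x ω) := by
    ext ω ⟨k, i⟩
    simp [stack, residualMap_apply, h k ω]
  have hsm : Measurable (stack y) := by
    rw [hstack]
    exact (residualMap Γ).continuous_of_finiteDimensional.measurable.comp hx.measurable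
  have hym : ∀ k, Measurable (y k) := fun k ↦ measurable_pi_lambda _ fun i ↦
    (measurable_pi_apply (k, i)).comp hsm
  have hjoint : HasGaussianLaw (fun ω ↦ (stack y ω, x c ω)) P := by
    rw [hstack]
    exact hx.gaussian.map_fun (LinearMap.toContinuousLinearMap ((residualMap Γ).prod (stateAt d c)))
  -- Uncorrelated and jointly Gaussian implies independent.
  have hindep : IndepFun (stack y) (x c) P :=
    HasGaussianLaw.indepFun_of_covariance_eval (X := fun p ω ↦ stack y ω p)
      (Y := fun j ω ↦ x c ω j) hjoint hunc
  refine isMarkovGiven_iff_isMarkovSeq (sigmaOf_le hxm _) hym (fun k ↦ hxm k)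
    (sigmaOf_dropAt_sup h) ?_
  rw [sigmaOf_singleton]
  refine indep_of_indep_of_le_left hindep (iSup₂_le fun k _ ↦ ?_)
  have hk : y k = (fun u i ↦ u (k, i)) ∘ stack y := rfl
  rw [hk, ← MeasurableSpace.comap_comp]
  refine MeasurableSpace.comap_mono (Measurable.comap_le ?_)
  exact measurable_pi_lambda _ fun i ↦ measurable_pi_apply (k, i)

/-- The hypothesis on `Γ` is the normal equation of least squares. -/
lemma uncorrelated_residualMap [Fintype ι] [DecidableEq ι] {x : ι → Ω → Fin d → ℝ}
    (hx : IsZMNG P (stack x)) (hxc : IsZMNG P (x c))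
    {Γ : {k : ι // k ≠ c} → Matrix (Fin d) (Fin d) ℝ}
    (hΓ : ∀ k : {k : ι // k ≠ c}, Γ k * covMatrix P (x c) =
      Matrix.of fun i j ↦ cov[fun ω ↦ x k ω i, fun ω ↦ x c ω j; P]) :
    Uncorrelated P (fun ω ↦ residualMap Γ (stack x ω)) (x c) := by
  rintro ⟨k, i⟩ j
  have hm := fun l ↦ (hxc.memLp l).const_mul (Γ k i l)
  have := congrFun₂ (hΓ k) i j
  simp only [Matrix.mul_apply, covMatrix, Matrix.of_apply] at this
  simp only [residualMap_apply, stack, Matrix.mulVec, dotProduct]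
  have hki : MemLp (fun ω ↦ x k ω i) 2 P := hx.memLp (k.1, i)
  rw [covariance_fun_sub_left hki (memLp_finsetSum _ fun l _ ↦ hm l)
    (hxc.memLp j), covariance_fun_sum_left hm (hxc.memLp j)]
  simp only [covariance_const_mul_left]
  exact sub_eq_zero.2 this.symm

end Residual

theorem mainTheorem2 {Ω : Type*} [MeasurableSpace Ω] (P : Measure Ω) [IsProbabilityMeasure P]
    (N d : ℕ) (c : Fin (N + 1)) (hc : c = 0 ∨ c = Fin.last N)
    (x : Fin (N + 1) → Ω → Fin d → ℝ) (hx : IsZMNG P (stack x)) :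
    IsCM P c x ↔
      ∃ (y : {k : Fin (N + 1) // k ≠ c} → Ω → Fin d → ℝ)
        (Γ : {k : Fin (N + 1) // k ≠ c} → Matrix (Fin d) (Fin d) ℝ),
        IsZMNG P (stack y) ∧ IsMarkovSeq P y ∧
        IsZMNG P (x c) ∧ Uncorrelated P (stack y) (x c) ∧
        ∀ k : {k : Fin (N + 1) // k ≠ c}, ∀ ω, x k ω = y k ω + (Γ k).mulVec (x c ω) := by
  constructor
  · intro h
    have hxc : IsZMNG P (x c) := hx.map_surjective (stateAt d c) (stateAt_surjective c)
    -- The solution of the normal equation; the inverse is genuine because `x c` has nonsingular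
    -- covariance.
    let Γ : {k : Fin (N + 1) // k ≠ c} → Matrix (Fin d) (Fin d) ℝ := fun k ↦
      (Matrix.of fun i j ↦ cov[fun ω ↦ x k ω i, fun ω ↦ x c ω j; P]) * (covMatrix P (x c))⁻¹
    let y : {k : Fin (N + 1) // k ≠ c} → Ω → Fin d → ℝ :=
      fun k ω i ↦ residualMap Γ (stack x ω) (k, i)
    have hy : IsZMNG P (stack y) := hx.map_surjective (residualMap Γ) (residualMap_surjective Γ)
    have hunc : Uncorrelated P (stack y) (x c) :=
      uncorrelated_residualMap hx hxc fun k ↦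
        Matrix.nonsing_inv_mul_cancel_right _ _ hxc.nonsingular.isUnit
    have hdec : ∀ k : {k : Fin (N + 1) // k ≠ c}, ∀ ω,
        x k ω = y k ω + (Γ k).mulVec (x c ω) := by
      intro k ω
      ext i
      simp [y, residualMap_apply, stack]
    exact ⟨y, Γ, hy, (isCM_iff_isMarkovSeq hx hunc hdec).1 h, hxc, hunc, hdec⟩
  · rintro ⟨y, Γ, -, hmar, -, hunc, hdec⟩
    exact (isCM_iff_isMarkovSeq hx hunc hdec).2 hmar
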